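/- For a prime $p$ let $R_p=\mathbb{Z}[1/p]$ be the subring of $\mathbb{Q}$ generated by $1/p$. A subgroup $M$ of an abelian group $N$ is pure, written $M\leq_{\mathrm{pure}}N$, if $nN\cap M=nM$ for all $n\in\mathbb{N}$. For an abstract elementary class (AEC) $\mathfrak{K}=(\mathbf{K},\preccurlyeq)$ and $M\in\mathbf{K}$, consider triples $(b,M,N)$ with $M\preccurlyeq N\in\mathbf{K}$ and $b\in N$; the set $\mathcal{S}_{\mathfrak{K}}(M)$ of orbital types over $M$ is the set of classes of such triples modulo the transitive closure of the relation "there are $N\in\mathbf{K}$ and $\mathfrak{K}$-embeddings $f_\ell:N_\ell\to N$ over $M$ ($\ell=1,2$) with $f_1(b_1)=f_2(b_2)$". The class $\mathfrak{K}$ is $\mu$-stable if $|\mathcal{S}_{\mathfrak{K}}(M)|\leq\mu$ for every $M\in\mathbf{K}$ of cardinality $\mu$; it is stable if it is $\mu$-stable for unboundedly many cardinals $\mu$, and unstable otherwise. **Theorem 1.2.** For every prime $p$ there is a class $\mathbf{K}$ of torsion-free abelian groups such that $(\mathbf{K},\leq_{\mathrm{pure}})$ is an AEC and is unstable. Moreover,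 $\mathbf{K}$ can be chosen so that $(\mathbf{K},\leq_{\mathrm{pure}})$ is not $\mu$-stable for any infinite cardinal $\mu$, and so that for every infinite cardinal $\lambda$ the group $G_\lambda=\bigoplus_{\alpha<\lambda}R_{p}x_\alpha$ belongs to $\mathbf{K}$ and there is a family $(t_{\mathcal U})_{\mathcal U\subseteq\lambda}$ of pairwise distinct orbital types over $G_\lambda$; in particular there are at least $2^\lambda$ orbital types over $G_\lambda$. -/

import Mathlib

open scoped Cardinal

universe u

/-- A class of abelian groups together with a binary relation `M ≼ N` between members and their
subgroups: `K.Mem G` says that `G` belongs to the class, and `K.Strong M`, for a subgroup `M` of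
`N`, says that `M ≼ N`. -/
structure AbClass where
  Mem : ∀ (G : Type u) [AddCommGroup G], Prop
  Strong : ∀ {N : Type u} [AddCommGroup N], AddSubgroup N → Prop

namespace AbClass

/-- `(K, ≼)` is an abstract elementary class (in the vocabulary of abelian groups). For subgroups
`L ≤ M` of `N`, the group `L` seen as a subgroup of `M` is `L.addSubgroupOf M`. -/
structure IsAEC (K : AbClass.{u}) : Prop where
  /-- the class is closed under isomorphisms -/
  mem_iso : ∀ {G H : Type u} [AddCommGroup G] [AddCommGroup H], (G ≃+ H) → K.Mem G → K.Mem H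
  /-- the relation is closed under isomorphisms -/
  strong_iso : ∀ {N N' : Type u} [AddCommGroup N] [AddCommGroup N'] (e : N ≃+ N')
    (M : AddSubgroup N), K.Strong M → K.Strong (M.map e.toAddMonoidHom)
  /-- `≼` is a relation on the class -/
  mem_of_strong : ∀ {N : Type u} [AddCommGroup N] (M : AddSubgroup N),
    K.Strong M → K.Mem M ∧ K.Mem N
  /-- `≼` is reflexive -/
  refl : ∀ {N : Type u} [AddCommGroup N], K.Mem N → K.Strong (⊤ : AddSubgroup N)
  /-- `≼` is transitive -/
  trans : ∀ {N : Type u} [AddCommGroup N] (L M : AddSubgroup N), L ≤ M →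
    K.Strong (L.addSubgroupOf M) → K.Strong M → K.Strong L
  /-- coherence: if `L ≼ N`, `M ≼ N` and `L ⊆ M`, then `L ≼ M` -/
  coherence : ∀ {N : Type u} [AddCommGroup N] (L M : AddSubgroup N), L ≤ M →
    K.Strong L → K.Strong M → K.Strong (L.addSubgroupOf M)
  /-- the Tarski-Vaught chain axioms: if `(C i)` is a `≼`-increasing chain indexed by a limit
  ordinal, then its union belongs to the class, each `C i` is `≼` the union, and the union is
  `≼ N` as soon as `C i ≼ N` for all `i`. The supremum of a chain of subgroups is its union. -/
  chain : ∀ {N : Type u} [AddCommGroup N] {I : Type u} [LinearOrder I] [WellFoundedLT I]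
    [Nonempty I] [NoMaxOrder I] (C : I → AddSubgroup N), Monotone C → (∀ i, K.Mem (C i)) →
    (∀ i j, i ≤ j → K.Strong ((C i).addSubgroupOf (C j))) →
    K.Mem (⨆ i, C i : AddSubgroup N) ∧
    (∀ i, K.Strong ((C i).addSubgroupOf (⨆ j, C j))) ∧
    ((∀ i, K.Strong (C i)) → K.Strong (⨆ i, C i))
  /-- the Löwenheim-Skolem-Tarski axiom -/
  lowenheimSkolem : ∃ κ : Cardinal.{u}, ℵ₀ ≤ κ ∧
    ∀ {N : Type u} [AddCommGroup N], K.Mem N → ∀ A : Set N,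
      ∃ M : AddSubgroup N, A ⊆ M ∧ K.Strong M ∧ #M ≤ #A + κ

/-- `f` is a `K`-embedding: an isomorphism of `M` onto some `M' ≼ N`. -/
structure IsEmb (K : AbClass.{u}) {M N : Type u} [AddCommGroup M] [AddCommGroup N]
    (f : M →+ N) : Prop where
  injective : Function.Injective f
  strong_range : K.Strong f.range

/-- A triple `(b, M, N)` with `M ≼ N` and `b ∈ N`; the inclusion of `M` in `N` is given as a
`K`-embedding. -/
structure PointedExt (K : AbClass.{u}) (M : Type u) [AddCommGroup M] where
  N : Type u
  [inst : AddCommGroup N]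
  mem : K.Mem N
  incl : M →+ N
  isEmb : K.IsEmb incl
  pt : N

attribute [instance] PointedExt.inst

/-- `(b₁, M, N₁)` and `(b₂, M, N₂)` are identified by two `K`-embeddings of `N₁`, `N₂` over `M`
into some member `N` of the class. -/
def AtomicEquiv (K : AbClass.{u}) {M : Type u} [AddCommGroup M] (s t : K.PointedExt M) : Prop :=
  ∃ (N : Type u) (_ : AddCommGroup N) (f : s.N →+ N) (g : t.N →+ N),
    K.Mem N ∧ K.IsEmb f ∧ K.IsEmb g ∧ (∀ m : M, f (s.incl m) = g (t.incl m)) ∧ f s.pt = g t.pt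

/-- The set `S(M)` of orbital (Galois) types of elements over `M`: the quotient of the triples
`(b, M, N)` by the equivalence relation generated by `AtomicEquiv` (for an abstract elementary
class `AtomicEquiv` is reflexive and symmetric, so this is its transitive closure). -/
def OrbitalType (K : AbClass.{u}) (M : Type u) [AddCommGroup M] : Type (u + 1) :=
  Quot (K.AtomicEquiv (M := M))

/-- `K` is `μ`-stable: `|S(M)| ≤ μ` for every member `M` of cardinality `μ`. -/
def StableIn (K : AbClass.{u}) (μ : Cardinal.{u}) : Prop :=
  ∀ (M : Type u) [AddCommGroup M], K.Mem M → #M = μ →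
    #(K.OrbitalType M) ≤ Cardinal.lift.{u + 1} μ

/-- `K` is stable: `μ`-stable for unboundedly many cardinals `μ`. -/
def Stable (K : AbClass.{u}) : Prop :=
  ∀ κ : Cardinal.{u}, ∃ μ : Cardinal.{u}, κ ≤ μ ∧ K.StableIn μ

end AbClass

/-- `M` is a pure subgroup of `N`: `nN ∩ M = nM` for all `n`. -/
def IsPureSubgroup {N : Type u} [AddCommGroup N] (M : AddSubgroup N) : Prop :=
  ∀ (n : ℕ), ∀ x ∈ M, (∃ y : N, n • y = x) → ∃ y ∈ M, n • y = x

/-- The pair `(K, ≤_pure)`, for a class `K` of abelian groups. -/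
def pureClass (K : ∀ (G : Type u) [AddCommGroup G], Prop) : AbClass.{u} where
  Mem := K
  Strong := fun {N} [AddCommGroup N] (M : AddSubgroup N) => K M ∧ K N ∧ IsPureSubgroup M

/-- `R_p`, the subring of `ℚ` generated by `1 / p`. -/
def ringInv (p : ℕ) : Subring ℚ := Subring.closure {(1 / p : ℚ)}

/-!
Write `D m G` (`infDivisible m G`) for the subgroup of elements of `G` divisible by all powers of
`m`. Fix primes `q ≠ r` different from `p`. The class `K` consists of the torsion-free groups `G`
such that either `D q G = 0` or `G = D q G ⊕ D r G` (`IsSplit`).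

A pure subgroup `M` of `G` satisfies `D m M = M ∩ D m G`. Therefore `K` is closed under unions of
chains of pure subgroups, and a set `A` lies in a small pure subgroup that belongs to `K`: the pure
hull of `A` and its projections. The remaining axioms concern purity alone, so `(K, ≤_pure)` is an
abstract elementary class (`isAEC_pureClass_isSplit`).

It is unstable because amalgamation fails. A nonzero element of `D q N` forces `N = D q N ⊕ D r
N`, hence forces every `m` in a pure subgroup `M` of `N` to have a component in `D q N`, which by
uniqueness is the same in all larger members of the class. By purity, whether this component is
divisible by a prime `ℓ` is then an invariant of the orbital type of that element over `M`
(`typeInvariant`). The group `⨁ ℤ[1/p] x_α` itself satisfies `D q = 0` and so leaves these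
components undetermined: for a set `U` of indices, the map sending `x_α` to `(ℓ x_α, x_α)` or to
`(x_α, x_α)` according to whether `α ∈ U` is a pure embedding into `⨁ ℤ[1/pq] ⊕ ⨁ ℤ[1/pr]`
(`twistedDiagonal`), and the `q`-component of `x_α` is divisible by `ℓ` exactly when `α ∈ U`.
Different sets `U` thus give different types.
-/

/-! ### Elements divisible by all powers of an integer -/

section InfinitelyDivisible

/-- The elements of `G` that are divisible by all powers of `m`. -/
def infDivisible (m : ℕ) (G : Type*) [AddCommGroup G] : AddSubgroup G where
  carrier := {x | ∀ n : ℕ, ∃ y : G, m ^ n • y = x}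
  zero_mem' n := ⟨0, smul_zero _⟩
  add_mem' {a b} ha hb n := by
    obtain ⟨y, rfl⟩ := ha n
    obtain ⟨z, rfl⟩ := hb n
    exact ⟨y + z, smul_add _ _ _⟩
  neg_mem' {a} ha n := by
    obtain ⟨y, rfl⟩ := ha n
    exact ⟨-y, smul_neg _ _⟩

variable {G H : Type*} [AddCommGroup G] [AddCommGroup H] {m : ℕ}

lemma map_mem_infDivisible (f : G →+ H) {x : G} (hx : x ∈ infDivisible m G) :
    f x ∈ infDivisible m H := fun n ↦ by
  obtain ⟨y, rfl⟩ := hx n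
  exact ⟨f y, (map_nsmul f _ y).symm⟩

lemma exists_nsmul_eq_of_isPureSubgroup_range {f : G →+ H} (hf : Function.Injective f)
    (hp : IsPureSubgroup f.range) {n : ℕ} {x : G} (h : ∃ y : H, n • y = f x) :
    ∃ y : G, n • y = x := by
  obtain ⟨_, ⟨y, rfl⟩, hy⟩ := hp n (f x) ⟨x, rfl⟩ h
  exact ⟨y, hf (by rw [map_nsmul, hy])⟩

lemma map_mem_infDivisible_iff {f : G →+ H} (hf : Function.Injective f)
    (hp : IsPureSubgroup f.range) {x : G} :
    f x ∈ infDivisible m H ↔ x ∈ infDivisible m G :=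
  ⟨fun h n ↦ exists_nsmul_eq_of_isPureSubgroup_range hf hp (h n), map_mem_infDivisible f⟩

lemma coe_mem_infDivisible_iff {M : AddSubgroup G} (hM : IsPureSubgroup M) {x : M} :
    (x : G) ∈ infDivisible m G ↔ x ∈ infDivisible m M :=
  map_mem_infDivisible_iff (f := M.subtype) M.subtype_injective (by rwa [M.range_subtype])

end InfinitelyDivisible

/-! ### Pure subgroups and pure hulls -/

section Purity

variable {G H : Type*} [AddCommGroup G] [AddCommGroup H]

lemma isPureSubgroup_top : IsPureSubgroup (⊤ : AddSubgroup G) :=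
  fun _ _ _ ⟨y, hy⟩ ↦ ⟨y, trivial, hy⟩

lemma isPureSubgroup_map_equiv (e : G ≃+ H) {M : AddSubgroup G} (hM : IsPureSubgroup M) :
    IsPureSubgroup (M.map e.toAddMonoidHom) := by
  rintro n _ ⟨x, hx, rfl⟩ ⟨y, hy⟩
  obtain ⟨z, hz, rfl⟩ := hM n x hx ⟨e.symm y, e.injective (by simpa using hy)⟩
  exact ⟨e z, ⟨z, hz, rfl⟩, (map_nsmul e n z).symm⟩

lemma isPureSubgroup_addSubgroupOf_iff {L M : AddSubgroup G} (h : L ≤ M) :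
    IsPureSubgroup (L.addSubgroupOf M) ↔
      ∀ n : ℕ, ∀ x ∈ L, (∃ y ∈ M, n • y = x) → ∃ y ∈ L, n • y = x := by
  constructor
  · rintro hL n x hx ⟨y, hy, hyx⟩
    obtain ⟨z, hz, hzx⟩ := hL n ⟨x, h hx⟩ hx ⟨⟨y, hy⟩, Subtype.ext hyx⟩
    exact ⟨z, hz, congrArg Subtype.val hzx⟩
  · rintro hL n x hx ⟨y, hyx⟩
    obtain ⟨z, hz, hzx⟩ := hL n x hx ⟨y, y.2, congrArg Subtype.val hyx⟩
    exact ⟨⟨z, h hz⟩, hz, Subtype.ext hzx⟩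

lemma isPureSubgroup_addSubgroupOf {L M : AddSubgroup G} (h : L ≤ M) (hL : IsPureSubgroup L) :
    IsPureSubgroup (L.addSubgroupOf M) :=
  (isPureSubgroup_addSubgroupOf_iff h).2 fun n x hx ⟨y, _, hy⟩ ↦ hL n x hx ⟨y, hy⟩

lemma IsPureSubgroup.trans {L M : AddSubgroup G} (h : L ≤ M)
    (hL : IsPureSubgroup (L.addSubgroupOf M)) (hM : IsPureSubgroup M) : IsPureSubgroup L :=
  fun n x hx hy ↦ (isPureSubgroup_addSubgroupOf_iff h).1 hL n x hx (hM n x (h hx) hy)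

/-- The smallest pure subgroup containing `B`, in a torsion-free group. -/
def pureHull (B : AddSubgroup G) : AddSubgroup G where
  carrier := {x | ∃ n : ℕ, n ≠ 0 ∧ n • x ∈ B}
  zero_mem' := ⟨1, one_ne_zero, by simp⟩
  add_mem' := by
    rintro a b ⟨n, hn, ha⟩ ⟨m, hm, hb⟩
    refine ⟨m * n, mul_ne_zero hm hn, ?_⟩
    rw [smul_add, mul_smul, mul_comm, mul_smul]
    exact B.add_mem (B.nsmul_mem ha m) (B.nsmul_mem hb n)
  neg_mem' := by
    rintro a ⟨n, hn, ha⟩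
    exact ⟨n, hn, by simpa using ha⟩

lemma le_pureHull (B : AddSubgroup G) : B ≤ pureHull B :=
  fun x hx ↦ ⟨1, one_ne_zero, by simpa using hx⟩

lemma isPureSubgroup_pureHull (B : AddSubgroup G) : IsPureSubgroup (pureHull B) := by
  rintro n x ⟨m, hm, hx⟩ ⟨y, rfl⟩
  rcases eq_or_ne n 0 with rfl | hn
  · exact ⟨0, zero_mem _, by simp⟩
  · exact ⟨y, ⟨m * n, mul_ne_zero hm hn, by rwa [mul_smul]⟩, rfl⟩

lemma map_mem_pureHull {B : AddSubgroup G} (f : G →+ G) (hf : ∀ x ∈ B, f x ∈ B) {x : G}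
    (hx : x ∈ pureHull B) : f x ∈ pureHull B := by
  obtain ⟨n, hn, h⟩ := hx
  exact ⟨n, hn, by simpa using hf _ h⟩

end Purity

/-! ### Cardinality of pure hulls -/

section Cardinality

variable {G : Type u} [AddCommGroup G]

lemma mk_closure_le (A : Set G) : #(AddSubgroup.closure A) ≤ max #A ℵ₀ := by
  have h : Function.Surjective
      (fun l : A →₀ ℤ ↦ (⟨Finsupp.linearCombination ℤ ((↑) : A → G) l, by
        rw [Finsupp.linearCombination_apply]
        exact AddSubgroup.sum_mem _ fun a _ ↦
          AddSubgroup.zsmul_mem _ (AddSubgroup.subset_closure a.2) _⟩ :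
        AddSubgroup.closure A)) := by
    rintro ⟨x, hx⟩
    rw [← Submodule.span_int_eq_addSubgroupClosure, Submodule.mem_toAddSubgroup,
      Finsupp.mem_span_iff_linearCombination] at hx
    obtain ⟨l, hl⟩ := hx
    exact ⟨l, Subtype.ext hl⟩
  refine (Cardinal.mk_le_of_surjective h).trans ?_
  rcases isEmpty_or_nonempty A with hA | hA
  · simp
  · simp

/-- An element `x` of the hull is determined by some `n ≠ 0` and `n • x ∈ B`. -/
lemma mk_pureHull_le [IsAddTorsionFree G] (B : AddSubgroup G) : #(pureHull B) ≤ max #B ℵ₀ := by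
  choose n hn hB using fun x : pureHull B ↦ x.2
  have h : Function.Injective (fun x : pureHull B ↦ ((⟨_, hB x⟩, n x) : B × ℕ)) := by
    intro x y hxy
    obtain ⟨h1, h2⟩ := Prod.ext_iff.1 hxy
    simp only [Subtype.mk.injEq] at h1 h2
    rw [h2] at h1
    exact Subtype.ext (nsmul_right_injective (hn y) h1)
  refine (Cardinal.mk_le_of_injective h).trans ?_
  rw [Cardinal.mk_prod, Cardinal.mk_nat, Cardinal.lift_aleph0, Cardinal.lift_uzero]
  exact (Cardinal.mul_le_max _ _).trans (by simp)

end Cardinality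

/-! ### The abstract elementary class of split groups -/

section SplitGroups

/-- The torsion-free groups `G` in which, as soon as there is a nonzero element divisible by all
powers of `q`, every element is uniquely the sum of one divisible by all powers of `q` and one
divisible by all powers of `r`. -/
def IsSplit (q r : ℕ) (G : Type u) [AddCommGroup G] : Prop :=
  IsAddTorsionFree G ∧
    (infDivisible q G = ⊥ ∨ IsCompl (infDivisible q G) (infDivisible r G))

variable {q r : ℕ} {G H : Type u} [AddCommGroup G] [AddCommGroup H]

lemma IsSplit.disjoint (h : IsSplit q r G) : Disjoint (infDivisible q G) (infDivisible r G) := by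
  obtain ⟨-, h | h⟩ := h
  · rw [h]
    exact disjoint_bot_left
  · exact h.disjoint

lemma IsSplit.exists_add_eq (h : IsSplit q r G) {b : G} (hb : b ∈ infDivisible q G) (h0 : b ≠ 0)
    (x : G) : ∃ y ∈ infDivisible q G, ∃ z ∈ infDivisible r G, y + z = x := by
  obtain ⟨-, h | h⟩ := h
  · rw [h] at hb
    exact absurd hb h0
  · exact AddSubgroup.mem_sup.1 (h.sup_eq_top ▸ AddSubgroup.mem_top x)

lemma IsSplit.of_forall (ht : IsAddTorsionFree G)
    (hd : Disjoint (infDivisible q G) (infDivisible r G))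
    (h : ∀ b ∈ infDivisible q G, b ≠ 0 → ∀ x : G,
      ∃ y ∈ infDivisible q G, ∃ z ∈ infDivisible r G, y + z = x) : IsSplit q r G := by
  refine ⟨ht, or_iff_not_imp_left.2 fun hq ↦ ⟨hd, codisjoint_iff.2 (eq_top_iff.2 fun x _ ↦ ?_)⟩⟩
  obtain ⟨⟨b, hb⟩, h0⟩ := AddSubgroup.ne_bot_iff_exists_ne_zero.1 hq
  exact AddSubgroup.mem_sup.2 (h b hb (fun h ↦ h0 (Subtype.ext h)) x)

lemma IsSplit.of_equiv (e : G ≃+ H) (h : IsSplit q r G) : IsSplit q r H := by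
  have ht := h.1
  have hs {m : ℕ} {x : H} (hx : x ∈ infDivisible m H) : e.symm x ∈ infDivisible m G :=
    map_mem_infDivisible e.symm.toAddMonoidHom hx
  have he {m : ℕ} {x : G} (hx : x ∈ infDivisible m G) : e x ∈ infDivisible m H :=
    map_mem_infDivisible e.toAddMonoidHom hx
  refine .of_forall (Function.Injective.isAddTorsionFree e.symm.toAddMonoidHom e.symm.injective)
      (AddSubgroup.disjoint_def.2 fun hx hy ↦ ?_) fun b hb h0 x ↦ ?_
  · simpa using AddSubgroup.disjoint_def.1 h.disjoint (hs hx) (hs hy)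
  · obtain ⟨y, hy, z, hz, hyz⟩ := h.exists_add_eq (hs hb) (by simpa using h0) (e.symm x)
    exact ⟨e y, he hy, e z, he hz, by rw [← map_add, hyz, e.apply_symm_apply]⟩

/-- A pure subgroup that is closed under the decomposition of the ambient group is split. -/
lemma IsSplit.of_isPureSubgroup (h : IsSplit q r G) {M : AddSubgroup G} (hM : IsPureSubgroup M)
    (hc : ∀ b ∈ infDivisible q G, b ≠ 0 → ∀ y ∈ infDivisible q G, ∀ z ∈ infDivisible r G,
      y + z ∈ M → y ∈ M) : IsSplit q r M := by
  have ht := h.1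
  refine .of_forall inferInstance
    (AddSubgroup.disjoint_def.2 fun {x} hx hy ↦ Subtype.ext ?_) fun b hb h0 x ↦ ?_
  · exact AddSubgroup.disjoint_def.1 h.disjoint ((coe_mem_infDivisible_iff hM).2 hx)
      ((coe_mem_infDivisible_iff hM).2 hy)
  · have hb' := (coe_mem_infDivisible_iff hM).2 hb
    have h0' : (b : G) ≠ 0 := by simpa using h0
    obtain ⟨y, hy, z, hz, hyz⟩ := h.exists_add_eq hb' h0' x
    have hyM := hc b hb' h0' y hy z hz (hyz ▸ x.2)
    have hzM : z ∈ M := by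
      rw [← add_sub_cancel_left y z, hyz]
      exact M.sub_mem x.2 hyM
    exact ⟨⟨y, hyM⟩, (coe_mem_infDivisible_iff hM).1 hy, ⟨z, hzM⟩,
      (coe_mem_infDivisible_iff hM).1 hz, Subtype.ext hyz⟩

lemma IsSplit.of_directed {I : Type*} [Nonempty I] {D : I → AddSubgroup G}
    (hD : Directed (· ≤ ·) D) (hcov : ∀ x, ∃ i, x ∈ D i) (hp : ∀ i, IsPureSubgroup (D i))
    (h : ∀ i, IsSplit q r (D i)) : IsSplit q r G := by
  have hc2 (x y : G) : ∃ i, x ∈ D i ∧ y ∈ D i := by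
    obtain ⟨i, hi⟩ := hcov x
    obtain ⟨j, hj⟩ := hcov y
    obtain ⟨k, hik, hjk⟩ := hD i j
    exact ⟨k, hik hi, hjk hj⟩
  refine .of_forall ⟨fun n hn x y hxy ↦ ?_⟩ (AddSubgroup.disjoint_def.2 fun {x} hx hy ↦ ?_)
    fun b hb h0 x ↦ ?_
  · obtain ⟨i, hx, hy⟩ := hc2 x y
    have := (h i).1
    exact congrArg Subtype.val
      (nsmul_right_injective hn (Subtype.ext hxy : n • (⟨x, hx⟩ : D i) = n • ⟨y, hy⟩))
  · obtain ⟨i, hi⟩ := hcov x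
    exact congrArg Subtype.val (AddSubgroup.disjoint_def.1 (h i).disjoint
      ((coe_mem_infDivisible_iff (x := ⟨x, hi⟩) (hp i)).1 hx)
      ((coe_mem_infDivisible_iff (x := ⟨x, hi⟩) (hp i)).1 hy))
  · obtain ⟨i, hbi, hxi⟩ := hc2 b x
    obtain ⟨y, hy, z, hz, hyz⟩ := (h i).exists_add_eq
      ((coe_mem_infDivisible_iff (x := ⟨b, hbi⟩) (hp i)).1 hb)
      (fun h ↦ h0 (congrArg Subtype.val h)) ⟨x, hxi⟩
    exact ⟨y, (coe_mem_infDivisible_iff (hp i)).2 hy, z, (coe_mem_infDivisible_iff (hp i)).2 hz,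
      congrArg Subtype.val hyz⟩

/-- The subgroup is the pure hull of `A` together with its projections to `infDivisible q G`. -/
lemma IsSplit.lowenheimSkolem (h : IsSplit q r G) (A : Set G) :
    ∃ M : AddSubgroup G, A ⊆ M ∧ IsSplit q r M ∧ IsPureSubgroup M ∧ #M ≤ #A + ℵ₀ := by
  have ht := h.1
  -- If `infDivisible q G` is trivial, the zero map serves as the projection `f`.
  obtain ⟨f, hff, hf⟩ : ∃ f : G →+ G, (∀ x, f (f x) = f x) ∧
      ∀ b ∈ infDivisible q G, b ≠ 0 → ∀ y ∈ infDivisible q G, ∀ z ∈ infDivisible r G,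
        f (y + z) = y := by
    obtain ⟨-, h | h⟩ := h
    · exact ⟨0, by simp, fun b hb h0 ↦ absurd (by simpa [h] using hb) h0⟩
    · have h' : IsCompl (AddSubgroup.toIntSubmodule (infDivisible q G))
          (AddSubgroup.toIntSubmodule (infDivisible r G)) :=
        (OrderIso.isCompl_iff AddSubgroup.toIntSubmodule).1 h
      refine ⟨(Submodule.projection _ _ h').toAddMonoidHom,
        fun x ↦ Submodule.projection_apply_of_mem_left h' (Submodule.projection_apply_mem h' x),
        fun b _ _ y hy z hz ↦ ?_⟩
      have h1 := Submodule.projection_apply_of_mem_left h' (x := y) hy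
      have h2 := (Submodule.projection_apply_eq_zero_iff h' (x := z)).2 hz
      simp [h1, h2]
  refine ⟨pureHull (AddSubgroup.closure (A ∪ f '' A)), fun x hx ↦ le_pureHull _
    (AddSubgroup.subset_closure (.inl hx)), h.of_isPureSubgroup (isPureSubgroup_pureHull _)
    fun b hb h0 y hy z hz hyz ↦ ?_, isPureSubgroup_pureHull _, ?_⟩
  · rw [← hf b hb h0 y hy z hz]
    refine map_mem_pureHull f (fun x hx ↦ ?_) hyz
    have : AddSubgroup.closure (A ∪ f '' A) ≤ (AddSubgroup.closure (A ∪ f '' A)).comap f := by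
      refine (AddSubgroup.closure_le _).2 ?_
      rintro x (hx | ⟨x, hx, rfl⟩)
      · exact AddSubgroup.subset_closure (.inr ⟨x, hx, rfl⟩)
      · exact AddSubgroup.subset_closure (.inr ⟨x, hx, (hff x).symm⟩)
    exact this hx
  · refine (mk_pureHull_le _).trans (max_le ((mk_closure_le _).trans (max_le ?_ ?_)) ?_)
    · rcases Set.finite_or_infinite A with hA | hA
      · exact ((hA.union (hA.image f)).lt_aleph0.le).trans (self_le_add_left _ _)
      · calc #(A ∪ f '' A : Set G) ≤ #A + #(f '' A) := Cardinal.mk_union_le _ _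
          _ ≤ #A + #A := by gcongr; exact Cardinal.mk_image_le
          _ = #A := Cardinal.add_eq_self (Cardinal.infinite_iff.1 hA.to_subtype)
          _ ≤ #A + ℵ₀ := self_le_add_right _ _
    · exact self_le_add_left _ _
    · exact self_le_add_left _ _

theorem isAEC_pureClass_isSplit (q r : ℕ) :
    (pureClass.{u} fun G [AddCommGroup G] ↦ IsSplit q r G).IsAEC where
  mem_iso e h := h.of_equiv e
  strong_iso e M := fun ⟨h, hN, hp⟩ ↦
    ⟨h.of_equiv (M.equivMapOfInjective _ e.injective), hN.of_equiv e, isPureSubgroup_map_equiv e hp⟩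
  mem_of_strong M h := ⟨h.1, h.2.1⟩
  refl h := ⟨h.of_equiv AddSubgroup.topEquiv.symm, h, isPureSubgroup_top⟩
  trans L M hLM := fun ⟨hL, _, hLp⟩ ⟨_, hN, hMp⟩ ↦
    ⟨hL.of_equiv (AddSubgroup.addSubgroupOfEquivOfLe hLM), hN, hLp.trans hLM hMp⟩
  coherence L M hLM := fun ⟨hL, _, hLp⟩ ⟨hM, _, _⟩ ↦
    ⟨hL.of_equiv (AddSubgroup.addSubgroupOfEquivOfLe hLM).symm, hM,
      isPureSubgroup_addSubgroupOf hLM hLp⟩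
  chain {N _ I _ _ _ _} C hC hmem hstr := by
    have hdir : Directed (· ≤ ·) C := hC.directed_le
    have hmemSup {x : N} : x ∈ (⨆ i, C i) ↔ ∃ i, x ∈ C i := AddSubgroup.mem_iSup_of_directed hdir
    have hle (i : I) : C i ≤ ⨆ j, C j := le_iSup C i
    have hpure (i : I) : IsPureSubgroup ((C i).addSubgroupOf (⨆ j, C j)) := by
      refine (isPureSubgroup_addSubgroupOf_iff (hle i)).2 fun n x hx ⟨y, hy, hyx⟩ ↦ ?_
      obtain ⟨j, hj⟩ := hmemSup.1 hy
      have hij : i ≤ max i j := le_max_left i j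
      exact (isPureSubgroup_addSubgroupOf_iff (hC hij)).1 (hstr i _ hij).2.2 n x hx
        ⟨y, hC (le_max_right i j) hj, hyx⟩
    have hsplit (i : I) : IsSplit q r ((C i).addSubgroupOf (⨆ j, C j)) :=
      (hmem i).of_equiv (AddSubgroup.addSubgroupOfEquivOfLe (hle i)).symm
    have hsup : IsSplit q r (⨆ i, C i : AddSubgroup N) := by
      refine .of_directed (D := fun i ↦ (C i).addSubgroupOf (⨆ j, C j)) (fun i j ↦ ?_)
        (fun x ↦ hmemSup.1 x.2) hpure hsplit
      obtain ⟨k, hi, hj⟩ := hdir i j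
      exact ⟨k, fun _ hx ↦ hi hx, fun _ hx ↦ hj hx⟩
    refine ⟨hsup, fun i ↦ ⟨hsplit i, hsup, hpure i⟩, fun h ↦ ⟨hsup, ?_, fun n x hx hy ↦ ?_⟩⟩
    · exact (h (Classical.arbitrary I)).2.1
    · obtain ⟨i, hi⟩ := hmemSup.1 hx
      obtain ⟨z, hz, hzx⟩ := (h i).2.2 n x hi hy
      exact ⟨z, hle i hz, hzx⟩
  lowenheimSkolem := ⟨ℵ₀, le_rfl, fun h A ↦ by
    obtain ⟨M, hA, hM, hp, hcard⟩ := h.lowenheimSkolem A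
    exact ⟨M, hA, ⟨hM, h, hp⟩, hcard⟩⟩

end SplitGroups

/-! ### An invariant of orbital types -/

section Invariant

variable {q r ℓ : ℕ} {G H M : Type u} [AddCommGroup G] [AddCommGroup H] [AddCommGroup M]

/-- `x` is the sum of an element divisible by all powers of `q` and by `ℓ`, and of an element
divisible by all powers of `r`. -/
def HasDivisiblePart (q r ℓ : ℕ) (x : G) : Prop :=
  ∃ y ∈ infDivisible q G, x - y ∈ infDivisible r G ∧ ∃ w, ℓ • w = y

/-- The witness lies in the smaller group because the decomposition that exists there is, by
uniqueness, also the one of the larger group. -/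
lemma hasDivisiblePart_map_iff (hG : IsSplit q r G) (hH : IsSplit q r H) {f : G →+ H}
    (hf : Function.Injective f) (hp : IsPureSubgroup f.range) {b : G}
    (hb : b ∈ infDivisible q G) (h0 : b ≠ 0) {x : G} :
    HasDivisiblePart q r ℓ (f x) ↔ HasDivisiblePart q r ℓ x := by
  constructor
  · rintro ⟨y, hy, hxy, hw⟩
    obtain ⟨y', hy', z', hz', rfl⟩ := hG.exists_add_eq hb h0 x
    have hyy : y = f y' := by
      refine sub_eq_zero.1 (AddSubgroup.disjoint_def.1 hH.disjoint
        (sub_mem hy (map_mem_infDivisible f hy')) ?_)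
      have := sub_mem (map_mem_infDivisible f hz') hxy
      rwa [map_add, show f z' - (f y' + f z' - y) = y - f y' by abel] at this
    subst hyy
    exact ⟨y', hy', by simpa using hz', exists_nsmul_eq_of_isPureSubgroup_range hf hp hw⟩
  · rintro ⟨y, hy, hxy, w, rfl⟩
    exact ⟨f (ℓ • w), map_mem_infDivisible f hy, by
      rw [← map_sub]
      exact map_mem_infDivisible f hxy, f w, (map_nsmul f ℓ w).symm⟩

/-- An invariant of orbital types: for types of a nonzero element divisible by all powers of `q`,
the set of `m` whose image has an `ℓ`-divisible part; for other types it is empty. -/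
def typeInvariant (q r ℓ : ℕ) {K : AbClass.{u}} (s : K.PointedExt M) : Set M :=
  {m | s.pt ∈ infDivisible q s.N ∧ s.pt ≠ 0 ∧ HasDivisiblePart q r ℓ (s.incl m)}

lemma typeInvariant_eq_of_atomicEquiv
    {s t : (pureClass.{u} fun G [AddCommGroup G] ↦ IsSplit q r G).PointedExt M}
    (h : AbClass.AtomicEquiv _ s t) : typeInvariant q r ℓ s = typeInvariant q r ℓ t := by
  obtain ⟨N, _, f, g, hN, ⟨hf, -, -, hfp⟩, ⟨hg, -, -, hgp⟩, hincl, hpt⟩ := h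
  have key {E : Type u} [AddCommGroup E] (hE : IsSplit q r E) {f : E →+ N}
      (hf : Function.Injective f) (hp : IsPureSubgroup f.range) (b x : E) :
      (b ∈ infDivisible q E ∧ b ≠ 0 ∧ HasDivisiblePart q r ℓ x) ↔
        (f b ∈ infDivisible q N ∧ f b ≠ 0 ∧ HasDivisiblePart q r ℓ (f x)) := by
    rw [map_mem_infDivisible_iff hf hp, map_ne_zero_iff f hf]
    exact and_congr_right fun hb ↦ and_congr_right fun h0 ↦
      (hasDivisiblePart_map_iff hE hN hf hp hb h0).symm
  ext m
  exact (key s.mem hf hfp _ _).trans (by rw [hpt, hincl]; exact (key t.mem hg hgp _ _).symm)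

end Invariant

/-! ### Divisibility in localizations of the integers -/

section Rational

variable {m d : ℕ}

lemma mem_ringInv_iff (hm : m ≠ 0) {t : ℚ} :
    t ∈ ringInv m ↔ ∃ (n : ℕ) (z : ℤ), (m : ℚ) ^ n * t = z := by
  have hm' : (m : ℚ) ≠ 0 := Nat.cast_ne_zero.2 hm
  constructor
  · intro ht
    unfold ringInv at ht
    induction ht using Subring.closure_induction with
    | mem x hx =>
      obtain rfl : x = 1 / m := hx
      exact ⟨1, 1, by simp [hm']⟩
    | zero => exact ⟨0, 0, by simp⟩
    | one => exact ⟨0, 1, by simp⟩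
    | add x y _ _ hx hy =>
      obtain ⟨a, z, hx⟩ := hx
      obtain ⟨b, w, hy⟩ := hy
      exact ⟨a + b, m ^ b * z + m ^ a * w, by push_cast; rw [← hx, ← hy]; ring⟩
    | neg x _ hx =>
      obtain ⟨a, z, hx⟩ := hx
      exact ⟨a, -z, by push_cast; rw [← hx]; ring⟩
    | mul x y _ _ hx hy =>
      obtain ⟨a, z, hx⟩ := hx
      obtain ⟨b, w, hy⟩ := hy
      exact ⟨a + b, z * w, by push_cast; rw [← hx, ← hy]; ring⟩
  · rintro ⟨n, z, h⟩
    have : t = z * (1 / m : ℚ) ^ n := by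
      rw [← h, one_div, inv_pow, mul_comm _ t, mul_inv_cancel_right₀ (pow_ne_zero n hm')]
    rw [this]
    have hmem : (1 / m : ℚ) ∈ ringInv m := Subring.subset_closure (Set.mem_singleton _)
    exact mul_mem (intCast_mem _ z) (pow_mem hmem n)

lemma ringInv_le_ringInv (hm : m ≠ 0) (hd : d ≠ 0) : ringInv m ≤ ringInv (m * d) := by
  intro t ht
  obtain ⟨n, z, h⟩ := (mem_ringInv_iff hm).1 ht
  exact (mem_ringInv_iff (mul_ne_zero hm hd)).2 ⟨n, d ^ n * z, by push_cast; rw [← h]; ring⟩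

/-- Divisibility in `ℤ[1/m]` by a number coprime to `m` is divisibility of the numerator. -/
lemma dvd_of_mul_eq_of_mem_ringInv (hm : m ≠ 0) (hd : d.Coprime m) {s t : ℚ}
    (hs : s ∈ ringInv m) (h : d * s = t) {n : ℕ} {z : ℤ} (hz : (m : ℚ) ^ n * t = z) :
    (d : ℤ) ∣ z := by
  obtain ⟨k, w, hw⟩ := (mem_ringInv_iff hm).1 hs
  have hdvd : (d : ℤ) ∣ m ^ k * z :=
    ⟨m ^ n * w, by exact_mod_cast (by rw [← hz, ← hw, ← h]; ring :
      (m : ℚ) ^ k * z = d * (m ^ n * w))⟩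
  have hc : IsCoprime (d : ℤ) (m ^ k : ℤ) := by
    exact_mod_cast Nat.isCoprime_iff_coprime.2 (hd.pow_right k)
  exact hc.dvd_of_dvd_mul_left hdvd

lemma infDivisible_ringInv_eq_bot (hm : m ≠ 0) (hd : d.Coprime m) (hd1 : 1 < d) :
    infDivisible d (ringInv m) = ⊥ := by
  refine (AddSubgroup.eq_bot_iff_forall _).2 fun t ht ↦ ?_
  obtain ⟨n, z, hz⟩ := (mem_ringInv_iff hm).1 t.2
  have hz0 : z = 0 := by
    by_contra h0
    -- The exponent is large enough for `d ^ |z| ∣ z` to be absurd.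
    obtain ⟨s, hs⟩ := ht z.natAbs
    have hs' : ((d ^ z.natAbs : ℕ) : ℚ) * s = t := by simpa using congrArg Subtype.val hs
    have := Int.natAbs_dvd_natAbs.2
      (dvd_of_mul_eq_of_mem_ringInv hm (hd.pow_left _) s.2 hs' hz)
    rw [Int.natAbs_natCast] at this
    exact (Nat.lt_pow_self hd1).not_ge (Nat.le_of_dvd (Int.natAbs_pos.2 h0) this)
  have hm' : (m : ℚ) ^ n ≠ 0 := pow_ne_zero n (Nat.cast_ne_zero.2 hm)
  exact Subtype.ext ((mul_eq_zero.1 (hz.trans (by simp [hz0]))).resolve_left hm')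

/-- This is what makes twisted diagonals pure: no denominators `r` survive when `k` and `q` are
coprime to `r`. -/
lemma mem_ringInv_of_mul_mem {p q r k : ℕ} (hp : p ≠ 0) (hq : q ≠ 0) (hr : r ≠ 0)
    (hk : k.Coprime r) (hqr : q.Coprime r) {t : ℚ} (h1 : t ∈ ringInv (p * r))
    (h2 : k * t ∈ ringInv (p * q)) : t ∈ ringInv p := by
  obtain ⟨a, z, hz⟩ := (mem_ringInv_iff (mul_ne_zero hp hr)).1 h1
  obtain ⟨b, w, hw⟩ := (mem_ringInv_iff (mul_ne_zero hp hq)).1 h2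
  have hc : IsCoprime ((k * q ^ b : ℕ) : ℤ) ((r ^ a : ℕ) : ℤ) :=
    Nat.isCoprime_iff_coprime.2 ((hk.mul_left (hqr.pow_left b)).pow_right a)
  obtain ⟨u, v, huv⟩ := hc
  have huv' : (u * (k * q ^ b) + v * r ^ a : ℚ) = 1 := by exact_mod_cast huv
  refine (mem_ringInv_iff hp).2 ⟨a + b, u * p ^ a * w + v * p ^ b * z, ?_⟩
  calc (p : ℚ) ^ (a + b) * t = p ^ (a + b) * t * (u * (k * q ^ b) + v * r ^ a) := by
        rw [huv', mul_one]
    _ = _ := by push_cast at hz hw ⊢; rw [← hz, ← hw]; ring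

end Rational

/-! ### Twisted diagonal embeddings -/

section Model

lemma infDivisible_eq_top_of_inv {R G : Type*} [Ring R] [AddCommGroup G] [Module R G] {m : ℕ}
    {c : R} (hc : m • c = 1) : infDivisible m G = ⊤ := by
  refine eq_top_iff.2 fun x _ n ↦ ⟨c ^ n • x, ?_⟩
  rw [← smul_assoc, nsmul_eq_mul, Nat.cast_pow, ← (Nat.cast_commute m c).mul_pow, ← nsmul_eq_mul,
    hc, one_pow, one_smul]

lemma infDivisible_finsupp_eq_bot {I G : Type*} [AddCommGroup G] {m : ℕ}
    (h : infDivisible m G = ⊥) : infDivisible m (I →₀ G) = ⊥ := by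
  refine (AddSubgroup.eq_bot_iff_forall _).2 fun x hx ↦ Finsupp.ext fun i ↦ ?_
  simpa [h] using map_mem_infDivisible (Finsupp.applyAddHom i) hx

variable {q r ℓ : ℕ} {G H : Type u} [AddCommGroup G] [AddCommGroup H]

lemma infDivisible_prod_left (hG : infDivisible q G = ⊤) (hH : infDivisible q H = ⊥)
    {x : G × H} : x ∈ infDivisible q (G × H) ↔ x.2 = 0 := by
  constructor
  · intro hx
    simpa [hH] using map_mem_infDivisible (AddMonoidHom.snd G H) hx
  · obtain ⟨a, b⟩ := x
    rintro rfl
    exact map_mem_infDivisible (AddMonoidHom.inl G H) (hG ▸ AddSubgroup.mem_top a)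

lemma infDivisible_prod_right (hG : infDivisible r G = ⊥) (hH : infDivisible r H = ⊤)
    {x : G × H} : x ∈ infDivisible r (G × H) ↔ x.1 = 0 := by
  constructor
  · intro hx
    simpa [hG] using map_mem_infDivisible (AddMonoidHom.fst G H) hx
  · obtain ⟨a, b⟩ := x
    rintro rfl
    exact map_mem_infDivisible (AddMonoidHom.inr G H) (hH ▸ AddSubgroup.mem_top b)

lemma isSplit_prod [IsAddTorsionFree G] [IsAddTorsionFree H]
    (hqG : infDivisible q G = ⊤) (hqH : infDivisible q H = ⊥)
    (hrG : infDivisible r G = ⊥) (hrH : infDivisible r H = ⊤) : IsSplit q r (G × H) := by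
  refine .of_forall inferInstance (AddSubgroup.disjoint_def.2 fun hx hy ↦ ?_) fun _ _ _ x ↦ ?_
  · exact Prod.ext ((infDivisible_prod_right hrG hrH).1 hy) ((infDivisible_prod_left hqG hqH).1 hx)
  · exact ⟨(x.1, 0), (infDivisible_prod_left hqG hqH).2 rfl, (0, x.2),
      (infDivisible_prod_right hrG hrH).2 rfl, by simp⟩

/-- In `G × H` the summands are the two factors, so the divisible part of `x` is `x.1`. -/
lemma hasDivisiblePart_prod_iff
    (hqG : infDivisible q G = ⊤) (hqH : infDivisible q H = ⊥)
    (hrG : infDivisible r G = ⊥) (hrH : infDivisible r H = ⊤) {x : G × H} :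
    HasDivisiblePart q r ℓ x ↔ ∃ w, ℓ • w = x.1 := by
  constructor
  · rintro ⟨y, -, hxy, w, rfl⟩
    exact ⟨w.1, (sub_eq_zero.1 ((infDivisible_prod_right hrG hrH).1 hxy)).symm⟩
  · rintro ⟨w, hw⟩
    exact ⟨(x.1, 0), (infDivisible_prod_left hqG hqH).2 rfl,
      (infDivisible_prod_right hrG hrH).2 (sub_self _), (w, 0), by simp [hw]⟩

lemma nsmul_finsupp_ringInv_eq {p : ℕ} {I : Type u} {f g : I →₀ ringInv p} {n : ℕ}
    (h : ∀ i, (n : ℚ) * g i = f i) : n • g = f := by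
  refine Finsupp.ext fun i ↦ Subtype.ext ?_
  rw [← h i, ← nsmul_eq_mul]
  exact map_nsmul ((ringInv p).subtype.toAddMonoidHom.comp (Finsupp.applyAddHom i)) n g

lemma exists_finsupp_ringInv_coe_eq {p m : ℕ} {I : Type u} (b : I →₀ ringInv m)
    (h : ∀ i, (b i : ℚ) ∈ ringInv p) : ∃ g : I →₀ ringInv p, ∀ i, (g i : ℚ) = b i :=
  ⟨Finsupp.onFinset b.support (fun i ↦ ⟨b i, h i⟩) fun i hi ↦ by
      rw [Finsupp.mem_support_iff]
      intro h0
      exact hi (Subtype.ext (by simp [h0])),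
    fun i ↦ by rw [Finsupp.onFinset_apply]⟩

/-- The embedding `f ↦ (k f, f)` of `⨁ ℤ[1/p]` into `⨁ ℤ[1/pq] × ⨁ ℤ[1/pr]`, for a function `k`
on the index set. -/
noncomputable def twistedDiagonal {p : ℕ} (I : Type u) (hp : p ≠ 0) (hq : q ≠ 0) (hr : r ≠ 0)
    (k : I → ℕ) :
    (I →₀ ringInv p) →+ (I →₀ ringInv (p * q)) × (I →₀ ringInv (p * r)) :=
  AddMonoidHom.prod
    ((DistribSMul.toAddMonoidHom _ fun i ↦ (k i : ringInv (p * q))).comp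
      (Finsupp.mapRange.addMonoidHom (Subring.inclusion (ringInv_le_ringInv hp hq)).toAddMonoidHom))
    (Finsupp.mapRange.addMonoidHom (Subring.inclusion (ringInv_le_ringInv hp hr)).toAddMonoidHom)

section TwistedDiagonal

variable {p : ℕ} {I : Type u} (hp : p ≠ 0) (hq : q ≠ 0) (hr : r ≠ 0) (k : I → ℕ)

lemma coe_twistedDiagonal_fst (f : I →₀ ringInv p) (i : I) :
    (((twistedDiagonal I hp hq hr k f).1 i : ringInv (p * q)) : ℚ) = k i * f i := by
  simp [twistedDiagonal]

lemma coe_twistedDiagonal_snd (f : I →₀ ringInv p) (i : I) :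
    (((twistedDiagonal I hp hq hr k f).2 i : ringInv (p * r)) : ℚ) = f i := by
  simp [twistedDiagonal]

lemma twistedDiagonal_injective : Function.Injective (twistedDiagonal I hp hq hr k) := by
  intro f g h
  ext i
  rw [← coe_twistedDiagonal_snd hp hq hr k, h, coe_twistedDiagonal_snd]

lemma isPureSubgroup_range_twistedDiagonal (hqr : q.Coprime r) (hk : ∀ i, (k i).Coprime r) :
    IsPureSubgroup (twistedDiagonal I hp hq hr k).range := by
  rintro n _ ⟨f, rfl⟩ ⟨⟨a, b⟩, hab⟩
  rcases eq_or_ne n 0 with rfl | hn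
  · exact ⟨0, zero_mem _, by rw [← hab]; simp⟩
  have hn' : (n : ℚ) ≠ 0 := Nat.cast_ne_zero.2 hn
  have h1 (i : I) : (n : ℚ) * a i = k i * f i := by
    rw [← coe_twistedDiagonal_fst hp hq hr k, ← hab]
    simp
  have h2 (i : I) : (n : ℚ) * b i = f i := by
    rw [← coe_twistedDiagonal_snd hp hq hr k, ← hab]
    simp
  have h3 (i : I) : (b i : ℚ) ∈ ringInv p := by
    refine mem_ringInv_of_mul_mem hp hq hr (hk i) hqr (b i).2 ?_
    have : (k i * b i : ℚ) = a i := mul_left_cancel₀ hn' (by rw [h1, ← h2]; ring)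
    rw [this]
    exact (a i).2
  obtain ⟨g, hg⟩ := exists_finsupp_ringInv_coe_eq b h3
  have hng : n • g = f := nsmul_finsupp_ringInv_eq fun i ↦ by rw [hg, h2]
  exact ⟨twistedDiagonal I hp hq hr k g, ⟨g, rfl⟩, by rw [← map_nsmul, hng]⟩

end TwistedDiagonal

end Model

/-! ### Types indexed by subsets -/

section ManyTypes

variable {p q r ℓ : ℕ} {I : Type u}

lemma exists_nsmul_eq_one_ringInv (hq : q ≠ 0) (hp : p ≠ 0) : ∃ c : ringInv (p * q), q • c = 1 := by
  have hp' : (p : ℚ) ≠ 0 := Nat.cast_ne_zero.2 hp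
  have hq' : (q : ℚ) ≠ 0 := Nat.cast_ne_zero.2 hq
  have hmem : (1 / (p * q : ℕ) : ℚ) ∈ ringInv (p * q) :=
    Subring.subset_closure (Set.mem_singleton _)
  refine ⟨⟨p * (1 / (p * q : ℕ) : ℚ), mul_mem (natCast_mem _ p) hmem⟩, Subtype.ext ?_⟩
  simp
  field_simp

lemma infDivisible_finsupp_ringInv_eq_top (hp : p ≠ 0) (hq : q ≠ 0) :
    infDivisible q (I →₀ ringInv (p * q)) = ⊤ := by
  obtain ⟨c, hc⟩ := exists_nsmul_eq_one_ringInv hq hp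
  exact infDivisible_eq_top_of_inv hc

lemma infDivisible_finsupp_ringInv_eq_bot {m : ℕ} (hm : m ≠ 0) (hq : 1 < q) (h : q.Coprime m) :
    infDivisible q (I →₀ ringInv m) = ⊥ :=
  infDivisible_finsupp_eq_bot (infDivisible_ringInv_eq_bot hm h hq)

lemma isSplit_finsupp_ringInv (hp : p.Prime) (hq : q.Prime) (hqp : q ≠ p) :
    IsSplit q r (I →₀ ringInv p) :=
  ⟨inferInstance, .inl (infDivisible_finsupp_ringInv_eq_bot hp.ne_zero hq.one_lt
    ((Nat.coprime_primes hq hp).2 hqp))⟩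

/-- All the types are realized by the same element of the same group
`⨁ ℤ[1/pq] × ⨁ ℤ[1/pr]`; only the embedding of `⨁ ℤ[1/p]` depends on the set. -/
theorem exists_injective_orbitalType [Nonempty I] (hp : p.Prime) (hq : q.Prime) (hr : r.Prime)
    (hl : ℓ.Prime) (hpq : p < q) (hqr : q < r) (hrl : r < ℓ) :
    ∃ t : Set I → (pureClass.{u} fun G [AddCommGroup G] ↦ IsSplit q r G).OrbitalType
      (I →₀ ringInv p), Function.Injective t := by
  classical
  have cop {a b : ℕ} (ha : a.Prime) (hb : b.Prime) (h : a ≠ b) : a.Coprime b :=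
    (Nat.coprime_primes ha hb).2 h
  have hp0 := hp.ne_zero
  have hq0 := hq.ne_zero
  have hr0 := hr.ne_zero
  have hqG : infDivisible q (I →₀ ringInv (p * q)) = ⊤ :=
    infDivisible_finsupp_ringInv_eq_top hp0 hq0
  have hrH : infDivisible r (I →₀ ringInv (p * r)) = ⊤ :=
    infDivisible_finsupp_ringInv_eq_top hp0 hr0
  have hqH : infDivisible q (I →₀ ringInv (p * r)) = ⊥ :=
    infDivisible_finsupp_ringInv_eq_bot (mul_ne_zero hp0 hr0) hq.one_lt
      ((cop hq hp (by lia)).mul_right (cop hq hr (by lia)))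
  have hrG : infDivisible r (I →₀ ringInv (p * q)) = ⊥ :=
    infDivisible_finsupp_ringInv_eq_bot (mul_ne_zero hp0 hq0) hr.one_lt
      ((cop hr hp (by lia)).mul_right (cop hr hq (by lia)))
  have hN : IsSplit q r ((I →₀ ringInv (p * q)) × (I →₀ ringInv (p * r))) :=
    isSplit_prod hqG hqH hrG hrH
  let k (U : Set I) (i : I) : ℕ := if i ∈ U then ℓ else 1
  have hk (U : Set I) (i : I) : (k U i).Coprime r := by
    by_cases hi : i ∈ U
    · simpa [k, hi] using cop hl hr (by lia)
    · simp [k, hi]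
  let i₀ : I := Classical.arbitrary I
  let s (U : Set I) : (pureClass.{u} fun G [AddCommGroup G] ↦ IsSplit q r G).PointedExt
      (I →₀ ringInv p) :=
    { N := (I →₀ ringInv (p * q)) × (I →₀ ringInv (p * r))
      mem := hN
      incl := twistedDiagonal I hp0 hq0 hr0 (k U)
      isEmb := ⟨twistedDiagonal_injective hp0 hq0 hr0 (k U),
        (isSplit_finsupp_ringInv hp hq (by lia)).of_equiv
          (AddMonoidHom.ofInjective (twistedDiagonal_injective hp0 hq0 hr0 (k U))), hN,
        isPureSubgroup_range_twistedDiagonal hp0 hq0 hr0 (k U) (cop hq hr (by lia)) (hk U)⟩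
      pt := (Finsupp.single i₀ 1, 0) }
  have hs (U : Set I) (i : I) : Finsupp.single i 1 ∈ typeInvariant q r ℓ (s U) ↔ i ∈ U := by
    have hpt : (s U).pt ∈ infDivisible q (s U).N := (infDivisible_prod_left hqG hqH).2 rfl
    have h0 : (s U).pt ≠ 0 := fun h ↦ by simpa [s] using congrArg Prod.fst h
    have : Finsupp.single i 1 ∈ typeInvariant q r ℓ (s U) ↔
        HasDivisiblePart q r ℓ (twistedDiagonal I hp0 hq0 hr0 (k U) (Finsupp.single i 1)) :=
      ⟨fun h ↦ h.2.2, fun h ↦ ⟨hpt, h0, h⟩⟩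
    rw [this, hasDivisiblePart_prod_iff hqG hqH hrG hrH]
    constructor
    · rintro ⟨w, hw⟩
      by_contra hi
      have h1 : (ℓ : ℚ) * w i = 1 := by
        have h2 := coe_twistedDiagonal_fst hp0 hq0 hr0 (k U) (Finsupp.single i 1) i
        rw [← hw] at h2
        simpa [k, hi] using h2
      have := dvd_of_mul_eq_of_mem_ringInv (mul_ne_zero hp0 hq0)
        ((cop hl hp (by lia)).mul_right (cop hl hq (by lia))) (w i).2 h1 (n := 0) (z := 1) (by simp)
      exact hl.one_lt.ne' (by simpa using Int.natAbs_dvd_natAbs.2 this)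
    · intro hi
      refine ⟨Finsupp.single i 1, Finsupp.ext fun j ↦ Subtype.ext ?_⟩
      rw [coe_twistedDiagonal_fst]
      rcases eq_or_ne i j with rfl | hij
      · simp [k, hi]
      · simp [hij]
  refine ⟨fun U ↦ Quot.mk _ (s U), fun U V h ↦ ?_⟩
  have h' : typeInvariant q r ℓ (s U) = typeInvariant q r ℓ (s V) :=
    congrArg (Quot.lift (typeInvariant q r ℓ) fun _ _ ↦ typeInvariant_eq_of_atomicEquiv) h
  ext i
  rw [← hs U, ← hs V, h']

end ManyTypes

/-! ### Instability -/

section Instability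

/-- If the direct sums of copies of `ℤ[1/p]` have as many types as subsets of the index set, then
the class is unstable in every infinite cardinal, as `⨁_{α < μ} ℤ[1/p]` has cardinality `μ`. -/
lemma not_stableIn_of_injective {p : ℕ} {K : AbClass.{u}}
    (hK : ∀ (I : Type u) [Infinite I], K.Mem (I →₀ ringInv p) ∧
      ∃ t : Set I → K.OrbitalType (I →₀ ringInv p), Function.Injective t)
    {μ : Cardinal.{u}} (hμ : ℵ₀ ≤ μ) : ¬ K.StableIn μ := by
  intro h
  have hI : Infinite μ.out := Cardinal.infinite_iff.2 (by rwa [Cardinal.mk_out])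
  obtain ⟨hmem, t, ht⟩ := hK μ.out
  have hcard : #(μ.out →₀ ringInv p) = μ := by
    rw [Cardinal.mk_finsupp_lift_of_infinite, Cardinal.mk_out, Cardinal.lift_uzero, max_eq_left]
    exact (Cardinal.lift_le_aleph0.2 Cardinal.mk_le_aleph0).trans hμ
  have h1 := Cardinal.mk_le_of_injective
    (ht.comp (Equiv.ulift.{u + 1} : ULift (Set μ.out) ≃ Set μ.out).injective)
  rw [Cardinal.mk_uLift, Cardinal.mk_set, Cardinal.mk_out] at h1
  exact (Cardinal.lift_le.1 (h1.trans (h _ hmem hcard))).not_gt (Cardinal.cantor μ)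

end Instability

theorem theorem1p2 (p : ℕ) (hp : p.Prime) :
    ∃ K : ∀ (G : Type u) [AddCommGroup G], Prop,
      (∀ (G : Type u) [AddCommGroup G], K G → IsAddTorsionFree G) ∧
      (pureClass K).IsAEC ∧
      ¬ (pureClass K).Stable ∧
      (∀ μ : Cardinal.{u}, ℵ₀ ≤ μ → ¬ (pureClass K).StableIn μ) ∧
      (∀ (I : Type u) [Infinite I],
        K (I →₀ ringInv p) ∧
        ∃ t : Set I → (pureClass K).OrbitalType (I →₀ ringInv p), Function.Injective t) := by
  obtain ⟨q, hpq, hq⟩ := Nat.exists_infinite_primes (p + 1)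
  obtain ⟨r, hqr, hr⟩ := Nat.exists_infinite_primes (q + 1)
  obtain ⟨ℓ, hrl, hl⟩ := Nat.exists_infinite_primes (r + 1)
  have htypes (I : Type u) [Infinite I] : IsSplit q r (I →₀ ringInv p) ∧
      ∃ t : Set I → (pureClass.{u} fun G [AddCommGroup G] ↦ IsSplit q r G).OrbitalType
        (I →₀ ringInv p), Function.Injective t :=
    ⟨isSplit_finsupp_ringInv hp hq (by lia),
      exists_injective_orbitalType hp hq hr hl hpq hqr hrl⟩
  have hunst (μ : Cardinal.{u}) (hμ : ℵ₀ ≤ μ) :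
      ¬ (pureClass.{u} fun G [AddCommGroup G] ↦ IsSplit q r G).StableIn μ :=
    not_stableIn_of_injective htypes hμ
  refine ⟨fun G [AddCommGroup G] ↦ IsSplit q r G, fun G _ h ↦ h.1, isAEC_pureClass_isSplit q r,
    fun h ↦ ?_, hunst, htypes⟩
  obtain ⟨μ, hμ, hst⟩ := h ℵ₀
  exact hunst μ hμ hst
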